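/- Let $P$ be a finite nonempty poset and let $\hat P=P\sqcup\{\hat 0,\hat 1\}$ be its bounded extension, obtained by adjoining a new minimum $\hat 0$ and a new maximum $\hat 1$. Let $Q_{\hat P}$ be the starred quiver given by the Hasse diagram of $\hat P$ with edges directed upwards, with normal vertices the elements of $P$ and starred vertices $\hat 0,\hat 1$. Its root polytope $\operatorname{Root}(Q_{\hat P})\subset\mathbb{R}^P$ is the convex hull of the vectors $e_b-e_a$ for cover relations $a\lessdot b$ of $\hat P$, where $e_{\hat 0}=e_{\hat 1}=0$. Let $\mathcal{O}(P)\subset\mathbb{R}^P$ be the order polytope, i.e. the set of functions $f:P\to[0,1]$ with $f(a)\le f(b)$ whenever $a\le b$. The poset $P$ is called ranked if for each $v\in P$ all maximal chains in $P\cup\{\hat 0\}$ from $\hat 0$ to $v$ have the same length, and graded if all maximal chains in $\hat P$ from $\hat 0$ to $\hat 1$ have the same length. Suppose that $P$ is ranked. Then the origin lies in the interior of $\operatorname{Root}(Q_{\hat P})$, and the face fan $\mathcal{F}$ of $\operatorname{Root}(Q_{\hat P})$ (the set of cones over its proper faces, the cone over the empty face being $\{0\}$) refines the inner normal fan $\mathcal{N}$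 of $\mathcal{O}(P)$ (the set of cones $\{w : w\cdot x\le w\cdot y \text{ for all } x\in F,\ y\in\mathcal{O}(P)\}$, where $F$ runs over the nonempty faces of $\mathcal{O}(P)$ and linear functionals are identified with vectors through the dot product). That is, $\mathcal{F}$ and $\mathcal{N}$ have the same set of rays, each maximal cone of $\mathcal{F}$ is contained in a maximal cone of $\mathcal{N}$, and each maximal cone of $\mathcal{N}$ is a union of maximal cones of $\mathcal{F}$. If moreover $P$ is graded, then $\mathcal{F}=\mathcal{N}$. -/

import Mathlib

/-! ### Starred quivers and root polytopes -/

/-- A starred quiver with normal vertices `V` and starred vertices `S`: a set of arrows between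
vertices, without loops, without arrows between two starred vertices, and whose underlying graph
is connected.  (There are no multiple arrows, so the arrows are given by a relation.) -/
structure StarredQuiver (V S : Type*) where
  Arr : V ⊕ S → V ⊕ S → Prop
  loopless : ∀ x, ¬ Arr x x
  no_arr_star_star : ∀ s t, ¬ Arr (Sum.inr s) (Sum.inr t)
  connected : ∀ x y, Relation.EqvGen Arr x y

namespace StarredQuiver

variable {V S : Type*}

open Classical in
/-- The point `u_a` attached to an arrow `a`: it is `e_j - e_i` for `a : υ_i → υ_j`, `e_j` for
`a : ⋆ → υ_j` and `-e_i` for `a : υ_i → ⋆`.  (The last case does not occur for arrows.) -/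
noncomputable def arrowVector : V ⊕ S → V ⊕ S → (V → ℝ)
  | Sum.inl i, Sum.inl j => Pi.single j 1 - Pi.single i 1
  | Sum.inr _, Sum.inl j => Pi.single j 1
  | Sum.inl i, Sum.inr _ => - Pi.single i 1
  | Sum.inr _, Sum.inr _ => 0

/-- The root polytope of a starred quiver: the convex hull of the points `u_a`. -/
noncomputable def rootPolytope (Q : StarredQuiver V S) : Set (V → ℝ) :=
  convexHull ℝ {u | ∃ x y, Q.Arr x y ∧ u = arrowVector x y}

end StarredQuiver

/-! ### Posets: bounded extension, ranked and graded posets, order polytope -/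

/-- The bounded extension of `P`, with `0̂ = ⊥` and `1̂ = ⊤` adjoined. -/
abbrev BoundedExtension (P : Type*) : Type _ := WithBot (WithTop P)

/-- The elements of the bounded extension as vertices of a quiver: the normal vertices are
the elements of `P`, and the two starred vertices are `⋆₀ = 0̂` and `⋆₁ = 1̂`. -/
def toBoundedExtension {P : Type*} : P ⊕ Fin 2 → BoundedExtension P
  | Sum.inl v => ((v : WithTop P) : WithBot (WithTop P))
  | Sum.inr 0 => ⊥
  | Sum.inr 1 => ⊤

theorem toBoundedExtension_surjective {P : Type*} :
    Function.Surjective (toBoundedExtension (P := P)) := by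
  intro x
  induction x using WithBot.recBotCoe with
  | bot => exact ⟨Sum.inr 0, rfl⟩
  | coe y =>
    induction y using WithTop.recTopCoe with
    | top => exact ⟨Sum.inr 1, rfl⟩
    | coe v => exact ⟨Sum.inl v, rfl⟩

theorem toBoundedExtension_injective {P : Type*} :
    Function.Injective (toBoundedExtension (P := P)) := by
  intro x y h
  rcases x with v | i <;> rcases y with w | j
  · have h1 : ((v : WithTop P) : WithBot (WithTop P)) = ((w : WithTop P) : WithBot (WithTop P)) := h
    rw [WithBot.coe_inj, WithTop.coe_inj] at h1
    rw [h1]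
  · fin_cases j
    · exact absurd h (WithBot.coe_ne_bot)
    · exact absurd (WithBot.coe_inj.1 h) (WithTop.coe_ne_top)
  · fin_cases i
    · exact absurd h.symm (WithBot.coe_ne_bot)
    · exact absurd (WithBot.coe_inj.1 h.symm) (WithTop.coe_ne_top)
  · fin_cases i <;> fin_cases j
    · rfl
    · exact absurd h.symm (WithBot.coe_ne_bot)
    · exact absurd h (WithBot.coe_ne_bot)
    · rfl

/-- In a finite poset, `a ≤ b` gives a path of covering relations from `a` to `b`. -/
theorem reflTransGen_covBy_of_le {α : Type*} [PartialOrder α] [Finite α] {a b : α} (h : a ≤ b) :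
    Relation.ReflTransGen (· ⋖ ·) a b := by
  classical
  have := Fintype.ofFinite α
  let : DecidableLE α := Classical.decRel _
  let : DecidableLT α := Classical.decRel _
  let : LocallyFiniteOrder α := Fintype.toLocallyFiniteOrder
  exact le_iff_reflTransGen_covBy.1 h

/-- The starred quiver of the bounded extension of a finite nonempty poset `P`: the Hasse diagram of
`P ∪ {0̂, 1̂}` directed upwards, with starred vertices `0̂` and `1̂`. -/
def posetQuiver (P : Type*) [PartialOrder P] [Finite P] [Nonempty P] :
    StarredQuiver P (Fin 2) where
  Arr x y := toBoundedExtension x ⋖ toBoundedExtension y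
  loopless x h := h.lt.ne rfl
  no_arr_star_star s t h := by
    obtain ⟨v⟩ := ‹Nonempty P›
    have hb : (⊥ : BoundedExtension P) < ((v : WithTop P) : WithBot (WithTop P)) :=
      WithBot.bot_lt_coe _
    have ht : ((v : WithTop P) : WithBot (WithTop P)) < (⊤ : BoundedExtension P) :=
      WithBot.coe_lt_coe.2 (WithTop.coe_lt_top v)
    fin_cases s <;> fin_cases t
    · exact h.lt.ne rfl
    · exact h.2 hb ht
    · exact absurd h.lt not_top_lt
    · exact h.lt.ne rfl
  connected := by
    have : Finite (BoundedExtension P) := Finite.of_surjective _ toBoundedExtension_surjective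
    have key : ∀ a b : BoundedExtension P, Relation.ReflTransGen (· ⋖ ·) a b →
        ∀ x y, toBoundedExtension x = a → toBoundedExtension y = b →
          Relation.EqvGen (fun x y : P ⊕ Fin 2 => toBoundedExtension x ⋖ toBoundedExtension y)
            x y := by
      intro a b h
      induction h with
      | refl =>
        intro x y hx hy
        rw [toBoundedExtension_injective (hx.trans hy.symm)]
        exact Relation.EqvGen.refl _
      | @tail c d hac hcd ih =>
        intro x y hx hy
        obtain ⟨z, hz⟩ := toBoundedExtension_surjective c
        refine Relation.EqvGen.trans _ z _ (ih x z hx hz) (Relation.EqvGen.rel _ _ ?_)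
        rw [hz, hy]
        exact hcd
    have top : ∀ x, Relation.EqvGen
        (fun x y : P ⊕ Fin 2 => toBoundedExtension x ⋖ toBoundedExtension y) x (Sum.inr 1) :=
      fun x => key _ _ (reflTransGen_covBy_of_le (le_top (a := toBoundedExtension x))) x _ rfl rfl
    exact fun x y => Relation.EqvGen.trans _ _ _ (top x) (Relation.EqvGen.symm _ _ (top y))

/-- `c` is a maximal chain from `a` to `b`: an inclusion-maximal chain in the interval `[a, b]`. -/
def IsMaxChainBetween {α : Type*} [PartialOrder α] (a b : α) (c : Set α) : Prop :=
  Maximal (fun s : Set α => s ⊆ Set.Icc a b ∧ IsChain (· ≤ ·) s) c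

/-- `P` is ranked: for each `v : P`, all maximal chains in `P ∪ {0̂}` from `0̂` to `v` have the
same length.  (The length of a chain is its number of elements minus one, so equality of lengths
is equality of cardinalities.) -/
def IsRankedPoset (P : Type*) [PartialOrder P] : Prop :=
  ∀ v : P, ∀ c c' : Set (WithBot P),
    IsMaxChainBetween ⊥ (v : WithBot P) c → IsMaxChainBetween ⊥ (v : WithBot P) c' →
      c.ncard = c'.ncard

/-- `P` is graded: all maximal chains of the bounded extension from `0̂` to `1̂` have the same
length. -/
def IsGradedPoset (P : Type*) [PartialOrder P] : Prop :=
  ∀ c c' : Set (BoundedExtension P),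
    IsMaxChainBetween ⊥ ⊤ c → IsMaxChainBetween ⊥ ⊤ c' → c.ncard = c'.ncard

/-- The order polytope of `P`. -/
def orderPolytope (P : Type*) [PartialOrder P] : Set (P → ℝ) :=
  {f | (∀ v, 0 ≤ f v ∧ f v ≤ 1) ∧ ∀ v w, v ≤ w → f v ≤ f w}

/-! ### Face fans and normal fans

A fan is given by its set of cones.  The faces of a polytope `K` are its exposed faces
(`IsExposed`); these include the empty face and `K` itself. -/

section Fans

variable {V : Type*}

/-- The cone over a convex set `F`; the cone over the empty set is `{0}`. -/
def coneOver (F : Set (V → ℝ)) : Set (V → ℝ) :=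
  {y | y = 0 ∨ ∃ t : ℝ, 0 ≤ t ∧ ∃ x ∈ F, y = t • x}

/-- The face fan of a polytope `K` with the origin in its interior: the cones over the proper
faces of `K` (including the empty face). -/
def faceFan (K : Set (V → ℝ)) : Set (Set (V → ℝ)) :=
  {C | ∃ F, IsExposed ℝ K F ∧ F ≠ K ∧ C = coneOver F}

/-- The (inner) normal cone of `K` at `F`: all functionals that are minimized over `K` at every
point of `F`.  Functionals on `ℝ^V` are identified with vectors through the dot product. -/
def normalCone [Fintype V] (K F : Set (V → ℝ)) : Set (V → ℝ) :=
  {w | F ⊆ {x | x ∈ K ∧ ∀ y ∈ K, w ⬝ᵥ x ≤ w ⬝ᵥ y}}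

/-- The (inner) normal fan of a polytope `K`: the normal cones of the nonempty faces of `K`. -/
def innerNormalFan [Fintype V] (K : Set (V → ℝ)) : Set (Set (V → ℝ)) :=
  {C | ∃ F, IsExposed ℝ K F ∧ F.Nonempty ∧ C = normalCone K F}

/-- The rays of a fan: its one-dimensional cones. -/
def fanRays (A : Set (Set (V → ℝ))) : Set (Set (V → ℝ)) :=
  {C | C ∈ A ∧ Module.finrank ℝ (Submodule.span ℝ C) = 1}

/-- The maximal cones of a fan: those maximal under inclusion. -/
def maximalCones (A : Set (Set (V → ℝ))) : Set (Set (V → ℝ)) :=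
  {C | Maximal (· ∈ A) C}

end Fans

/-! The two fans are compared through systems of inequalities with the same normals, the arrow
vectors `u e`.  For right-hand sides `b`, each point `x` of the polyhedron `{x | b e ≤ u e ⬝ᵥ x}`
gives the cone spanned by the `u e` whose inequality is tight at `x`; call these the support cones
of the system.

* With `b = -1` the polyhedron is minus the polar of the root polytope, and polarity
  (`faceFan_convexHull_range`) makes its support cones the face fan.  Since the origin is interior
  (`zero_mem_interior_rootPolytope`: the arrow vectors along a chain of `P̂` telescope, so small
  multiples of all `± e_v` lie in the polytope), Hahn-Banach shows that these cones cover the space.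
* With `b = -1` on the arrows to `1̂` and `b = 0` on the others the polyhedron is the order polytope,
  and its support cones are the inner normal fan (`innerNormalFan_halfSpaces`).

The bridge is the rank function `r`, which exists since `P` is ranked.  If `x` satisfies the first
system, `x + r` is monotone with nonnegative values, and it is equal at the two ends of each tight
arrow inside `P`, zero at the end of each tight arrow from `0̂` and positive at the start of each
tight arrow to `1̂`.  So the indicator function of `{x + r > 0}` is a point of the order polytope at
which everything tight at `x` is tight (`exists_tightAt_subset`): every cone of the face fan lies in
a cone of the normal fan.  As the former cover the space, so do the latter, and complementary
slackness identifies them with normal cones, without a separate Farkas lemma.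

The rays of both fans are the rays through the single `u e`, because each inequality of either
system defines a facet (`fanRays_supportCones`).  A maximal cone of the normal fan is a union of
maximal cones of the face fan because its relative interior points are covered only by cones inside
it, which are finitely many and closed (`eq_sUnion_maximalCones`).  In the graded case of total rank
`N`, `x ↦ (x + r) / N` maps the first polyhedron onto the order polytope and preserves tightness, so
the fans agree. -/

/-! ### Cones spanned by subfamilies of a finite vector configuration -/

section Configuration

variable {V ι : Type*} [Fintype V] [Fintype ι]

/-- The cone of nonnegative combinations of the vectors `u i`, `i ∈ T`.  Combinations run over all
indices, with coefficients vanishing outside `T`. -/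
def posHull (u : ι → V → ℝ) (T : Set ι) : Set (V → ℝ) :=
  {w | ∃ c : ι → ℝ, (∀ i, 0 ≤ c i) ∧ (∀ i, i ∉ T → c i = 0) ∧ w = ∑ i, c i • u i}

/-- The polyhedron cut out by the inequalities `b i ≤ u i ⬝ᵥ x`. -/
def halfSpaces (u : ι → V → ℝ) (b : ι → ℝ) : Set (V → ℝ) :=
  {x | ∀ i, b i ≤ u i ⬝ᵥ x}

/-- The indices of the inequalities `b i ≤ u i ⬝ᵥ x` that are equalities at `x`. -/
def tightAt (u : ι → V → ℝ) (b : ι → ℝ) (x : V → ℝ) : Set ι :=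
  {i | u i ⬝ᵥ x = b i}

/-- The cones spanned by the inner normals `u i` of the inequalities that are tight at some point
of the polyhedron. -/
def supportCones (u : ι → V → ℝ) (b : ι → ℝ) : Set (Set (V → ℝ)) :=
  {C | ∃ x ∈ halfSpaces u b, C = posHull u (tightAt u b x)}

/-- The support cones cover the whole space. -/
def IsCompleteSystem (u : ι → V → ℝ) (b : ι → ℝ) : Prop :=
  ∀ w : V → ℝ, ∃ x ∈ halfSpaces u b, w ∈ posHull u (tightAt u b x)

variable {u : ι → V → ℝ} {b b' : ι → ℝ}

omit [Fintype V] in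
theorem posHull_mono {S T : Set ι} (h : S ⊆ T) : posHull u S ⊆ posHull u T := by
  rintro w ⟨c, hc, hS, rfl⟩
  exact ⟨c, hc, fun i hi => hS i fun hi' => hi (h hi'), rfl⟩

omit [Fintype V] in
theorem mem_posHull_self {T : Set ι} {i : ι} (hi : i ∈ T) : u i ∈ posHull u T := by
  classical
  refine ⟨Pi.single i 1, fun j => ?_, fun j hj => ?_, ?_⟩
  · by_cases h : j = i
    · subst h; simp
    · simp [h]
  · have : j ≠ i := fun h => hj (h ▸ hi)
    simp [this]
  · simp [Pi.single_apply, ite_smul]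

theorem sum_smul_dotProduct (c : ι → ℝ) (x : V → ℝ) :
    (∑ i, c i • u i) ⬝ᵥ x = ∑ i, c i * (u i ⬝ᵥ x) := by
  simp [sum_dotProduct, smul_dotProduct]

theorem dotProduct_eq_of_mem_posHull {c : ι → ℝ} {x : V → ℝ}
    (hT : ∀ i, i ∉ tightAt u b x → c i = 0) :
    (∑ i, c i • u i) ⬝ᵥ x = ∑ i, c i * b i := by
  rw [sum_smul_dotProduct]
  refine Finset.sum_congr rfl fun i _ => ?_
  by_cases h : i ∈ tightAt u b x
  · rw [show u i ⬝ᵥ x = b i from h]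
  · rw [hT i h, zero_mul, zero_mul]

theorem le_dotProduct_of_mem_posHull {x y w : V → ℝ} (hy : y ∈ halfSpaces u b)
    (hw : w ∈ posHull u (tightAt u b x)) : w ⬝ᵥ x ≤ w ⬝ᵥ y := by
  obtain ⟨c, hc, hT, rfl⟩ := hw
  rw [dotProduct_eq_of_mem_posHull hT, sum_smul_dotProduct]
  exact Finset.sum_le_sum fun i _ => mul_le_mul_of_nonneg_left (hy i) (hc i)

/-- Complementary slackness: if a combination is minimized at `x`, only inequalities that are
tight at `y` too can occur in it. -/
theorem eq_zero_of_dotProduct_le {c : ι → ℝ} {x y : V → ℝ} (hc : ∀ i, 0 ≤ c i)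
    (hT : ∀ i, i ∉ tightAt u b x → c i = 0) (hy : y ∈ halfSpaces u b)
    (h : (∑ i, c i • u i) ⬝ᵥ y ≤ (∑ i, c i • u i) ⬝ᵥ x) :
    ∀ i, i ∉ tightAt u b y → c i = 0 := by
  rw [dotProduct_eq_of_mem_posHull hT, sum_smul_dotProduct] at h
  have hle : ∀ i ∈ Finset.univ, c i * b i ≤ c i * (u i ⬝ᵥ y) :=
    fun i _ => mul_le_mul_of_nonneg_left (hy i) (hc i)
  have heq := (Finset.sum_eq_sum_iff_of_le hle).1 (le_antisymm (Finset.sum_le_sum hle) h)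
  intro i hi
  by_contra hci
  exact hi (mul_left_cancel₀ hci (heq i (Finset.mem_univ i))).symm

/-- For a complete system, the support cone at `x` is the normal cone at `x`: completeness takes
the place of the Farkas lemma. -/
theorem mem_posHull_tightAt_iff (hb : IsCompleteSystem u b) {x w : V → ℝ}
    (hx : x ∈ halfSpaces u b) :
    w ∈ posHull u (tightAt u b x) ↔ ∀ y ∈ halfSpaces u b, w ⬝ᵥ x ≤ w ⬝ᵥ y := by
  refine ⟨fun hw y hy => le_dotProduct_of_mem_posHull hy hw, fun h => ?_⟩
  obtain ⟨z, hz, c, hc, hT, rfl⟩ := hb w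
  exact ⟨c, hc, eq_zero_of_dotProduct_le hc hT hx (h z hz), rfl⟩

theorem isClosed_of_mem_supportCones (hb : IsCompleteSystem u b) {C : Set (V → ℝ)}
    (hC : C ∈ supportCones u b) : IsClosed C := by
  obtain ⟨x, hx, rfl⟩ := hC
  have : posHull u (tightAt u b x) = ⋂ y ∈ halfSpaces u b, {w | w ⬝ᵥ x ≤ w ⬝ᵥ y} := by
    ext w
    simp [mem_posHull_tightAt_iff hb hx]
  rw [this]
  refine isClosed_biInter fun y _ => isClosed_le ?_ ?_
  · exact Continuous.dotProduct continuous_id continuous_const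
  · exact Continuous.dotProduct continuous_id continuous_const

theorem finite_supportCones (u : ι → V → ℝ) (b : ι → ℝ) : (supportCones u b).Finite := by
  refine (Set.finite_range (posHull u)).subset ?_
  rintro C ⟨x, -, rfl⟩
  exact ⟨_, rfl⟩

theorem exists_maximal_supportCones {C : Set (V → ℝ)} (hC : C ∈ supportCones u b) :
    ∃ D ∈ maximalCones (supportCones u b), C ⊆ D := by
  obtain ⟨D, hCD, hD⟩ := (finite_supportCones u b).exists_le_maximal hC
  exact ⟨D, hD, hCD⟩

/-! ### Refinement of complete systems with the same normals -/

theorem IsCompleteSystem.of_refines (hb : IsCompleteSystem u b)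
    (H : ∀ x ∈ halfSpaces u b, ∃ y ∈ halfSpaces u b', tightAt u b x ⊆ tightAt u b' y) :
    IsCompleteSystem u b' := by
  intro w
  obtain ⟨x, hx, hw⟩ := hb w
  obtain ⟨y, hy, hxy⟩ := H x hx
  exact ⟨y, hy, posHull_mono hxy hw⟩

theorem exists_maximal_superset
    (H : ∀ x ∈ halfSpaces u b, ∃ y ∈ halfSpaces u b', tightAt u b x ⊆ tightAt u b' y)
    {C : Set (V → ℝ)} (hC : C ∈ supportCones u b) :
    ∃ D ∈ maximalCones (supportCones u b'), C ⊆ D := by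
  obtain ⟨x, hx, rfl⟩ := hC
  obtain ⟨y, hy, hxy⟩ := H x hx
  obtain ⟨D, hD, h⟩ := exists_maximal_supportCones ⟨y, hy, rfl⟩
  exact ⟨D, hD, (posHull_mono hxy).trans h⟩

/-- A point `w` of a maximal cone `D` of the coarser system is the limit of the relative interior
points `w + t • w₀` of `D`.  A cone of the finer system through such a point lies in `D`, and
there are only finitely many of these, all closed. -/
theorem eq_sUnion_maximalCones (hb : IsCompleteSystem u b)
    (H : ∀ x ∈ halfSpaces u b, ∃ y ∈ halfSpaces u b', tightAt u b x ⊆ tightAt u b' y)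
    {D : Set (V → ℝ)} (hD : D ∈ maximalCones (supportCones u b')) :
    ∃ S ⊆ maximalCones (supportCones u b), D = ⋃₀ S := by
  classical
  refine ⟨{C | C ∈ maximalCones (supportCones u b) ∧ C ⊆ D}, fun C hC => hC.1, ?_⟩
  refine Set.Subset.antisymm ?_ (Set.sUnion_subset fun C hC => hC.2)
  obtain ⟨x, hx, hDx⟩ := hD.1
  set S := {C | C ∈ maximalCones (supportCones u b) ∧ C ⊆ D} with hS
  have hclosed : IsClosed (⋃₀ S) := by
    rw [Set.sUnion_eq_biUnion]
    refine Set.Finite.isClosed_biUnion ?_ ?_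
    · exact (finite_supportCones u b).subset fun C hC => hC.1.1
    · exact fun C hC => isClosed_of_mem_supportCones hb hC.1.1
  intro w hw
  rw [hDx] at hw
  obtain ⟨c, hc, hT, hwc⟩ := hw
  let w₀ : V → ℝ := ∑ i, (if i ∈ tightAt u b' x then (1 : ℝ) else 0) • u i
  have key : ∀ t : ℝ, 0 < t → w + t • w₀ ∈ ⋃₀ S := by
    intro t ht
    let d : ι → ℝ := fun i => c i + t * (if i ∈ tightAt u b' x then 1 else 0)
    have hd : ∀ i, 0 ≤ d i := fun i => by
      have := hc i
      simp only [d]; split_ifs <;> linarith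
    have hdT : ∀ i, i ∉ tightAt u b' x → d i = 0 := fun i hi => by simp [d, hi, hT i hi]
    have hdw : w + t • w₀ = ∑ i, d i • u i := by
      simp only [d, w₀, hwc, add_smul, Finset.sum_add_distrib, Finset.smul_sum, mul_smul]
    obtain ⟨z, hz, hwz⟩ := hb (w + t • w₀)
    obtain ⟨C, hC, hzC⟩ := exists_maximal_supportCones ⟨z, hz, rfl⟩
    refine ⟨C, ⟨hC, ?_⟩, hzC hwz⟩
    obtain ⟨z', hz', rfl⟩ := hC.1
    obtain ⟨y, hy, hzy⟩ := H z' hz'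
    have hwy : w + t • w₀ ∈ posHull u (tightAt u b' y) := posHull_mono hzy (hzC hwz)
    -- the coefficients `d i` are positive on `tightAt u b' x`, so all of it is tight at `y`
    have hle := le_dotProduct_of_mem_posHull hx hwy
    rw [hdw] at hle
    have hzero := eq_zero_of_dotProduct_le hd hdT hy hle
    have hsub : tightAt u b' x ⊆ tightAt u b' y := by
      intro i hi
      by_contra hiy
      have h0 := hzero i hiy
      have := hc i
      simp only [d, if_pos hi] at h0
      linarith
    have hDy : posHull u (tightAt u b' y) ⊆ D :=
      hD.2 ⟨y, hy, rfl⟩ (by rw [hDx]; exact posHull_mono hsub)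
    exact (posHull_mono hzy).trans hDy
  have hlim : Filter.Tendsto (fun t : ℝ => w + t • w₀) (nhdsWithin 0 (Set.Ioi 0)) (nhds w) := by
    have : Continuous fun t : ℝ => w + t • w₀ := by fun_prop
    have h := (this.tendsto 0).mono_left (nhdsWithin_le_nhds (s := Set.Ioi (0 : ℝ)))
    simpa using h
  exact hclosed.mem_of_tendsto hlim (Filter.eventually_of_mem self_mem_nhdsWithin key)

/-! ### One-dimensional support cones -/

omit [Fintype V] in
theorem posHull_eq_of_collinear {T : Set ι} {i : ι} (hi : i ∈ T)
    (h : ∀ j ∈ T, ∃ r : ℝ, 0 ≤ r ∧ u j = r • u i) : posHull u T = posHull u {i} := by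
  classical
  refine Set.Subset.antisymm ?_ (posHull_mono (by simpa using hi))
  rintro w ⟨c, hc, hT, rfl⟩
  have h' : ∀ j, ∃ r : ℝ, 0 ≤ r ∧ c j • u j = r • u i := by
    intro j
    by_cases hj : j ∈ T
    · obtain ⟨r, hr, hj'⟩ := h j hj
      exact ⟨c j * r, mul_nonneg (hc j) hr, by rw [hj', mul_smul]⟩
    · exact ⟨0, le_rfl, by simp [hT j hj]⟩
  choose r hr hru using h'
  refine ⟨Pi.single i (∑ j, r j), fun j => ?_, fun j hj => ?_, ?_⟩
  · by_cases hji : j = i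
    · subst hji; simpa using Finset.sum_nonneg fun j _ => hr j
    · simp [hji]
  · rw [Set.mem_singleton_iff] at hj
    simp [hj]
  · simp [hru, Finset.sum_smul, Pi.single_apply, ite_smul]

omit [Fintype V] in
theorem finrank_span_posHull_singleton {i : ι} (hi : u i ≠ 0) :
    Module.finrank ℝ (Submodule.span ℝ (posHull u {i})) = 1 := by
  have : Submodule.span ℝ (posHull u {i}) = Submodule.span ℝ {u i} := by
    refine le_antisymm (Submodule.span_le.2 ?_) (Submodule.span_mono ?_)
    · rintro w ⟨c, -, hT, rfl⟩
      refine Submodule.sum_mem _ fun j _ => ?_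
      by_cases hj : j = i
      · subst hj
        exact Submodule.smul_mem _ _ (Submodule.subset_span rfl)
      · rw [hT j hj, zero_smul]; exact Submodule.zero_mem _
    · simpa using mem_posHull_self (u := u) (Set.mem_singleton i)
  rw [this, finrank_span_singleton hi]

/-- If every inequality is the only tight one at some point, then the rays among the support cones
are exactly the rays spanned by the single vectors `u i`; in particular they do not depend on the
right-hand sides `b`. -/
theorem fanRays_supportCones (hu : ∀ i, u i ≠ 0)
    (hfacet : ∀ i, ∃ x ∈ halfSpaces u b, tightAt u b x = {i}) :
    fanRays (supportCones u b) = Set.range fun i => posHull u {i} := by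
  ext C
  constructor
  · rintro ⟨⟨x, hx, rfl⟩, hdim⟩
    set T := tightAt u b x with hT
    have hne : T.Nonempty := by
      by_contra hemp
      rw [Set.not_nonempty_iff_eq_empty] at hemp
      have h0 : Submodule.span ℝ (posHull u T) = ⊥ := by
        rw [Submodule.span_eq_bot]
        rintro w ⟨c, -, hc, rfl⟩
        exact Finset.sum_eq_zero fun j _ => by rw [hc j (by simp [hemp]), zero_smul]
      rw [h0] at hdim
      simp at hdim
    obtain ⟨i, hi⟩ := hne
    refine ⟨i, (posHull_eq_of_collinear hi fun j hj => ?_).symm⟩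
    let v : T → Submodule.span ℝ (posHull u T) :=
      fun k => ⟨u k, Submodule.subset_span (mem_posHull_self k.2)⟩
    have hv : v ⟨i, hi⟩ ≠ 0 := fun h => hu i (congrArg Subtype.val h)
    obtain ⟨r, hr⟩ := (finrank_eq_one_iff_of_nonzero' _ hv).1 hdim (v ⟨j, hj⟩)
    have hr' : r • u i = u j := congrArg Subtype.val hr
    refine ⟨r, ?_, hr'.symm⟩
    -- a negative multiple would make both inequalities equalities on the whole polyhedron
    by_contra! hneg
    obtain ⟨y, hy, hyi⟩ := hfacet i
    have h1 : u i ⬝ᵥ y = b i := by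
      have : i ∈ tightAt u b y := by simp [hyi]
      exact this
    have h2 : u i ⬝ᵥ x = b i := hi
    have h3 : u j ⬝ᵥ x = b j := hj
    have h4 : u j ⬝ᵥ y = b j := by
      rw [← h3, ← hr', smul_dotProduct, smul_dotProduct, h1, h2]
    have hji : j = i := by
      have : j ∈ tightAt u b y := h4
      simpa [hyi] using this
    subst hji
    have : (r - 1) • u j = 0 := by rw [sub_smul, hr', one_smul, sub_self]
    rcases smul_eq_zero.1 this with h | h
    · linarith
    · exact hu j h
  · rintro ⟨i, rfl⟩
    obtain ⟨x, hx, hxi⟩ := hfacet i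
    exact ⟨⟨x, hx, by rw [hxi]⟩, finrank_span_posHull_singleton (hu i)⟩

/-! ### The normal fan of a polyhedron -/

theorem normalCone_eq_posHull (hb : IsCompleteSystem u b) {F : Set (V → ℝ)} {x : V → ℝ}
    (hF : F ⊆ halfSpaces u b) (hx : x ∈ F) (h : ∀ y ∈ F, tightAt u b x ⊆ tightAt u b y) :
    normalCone (halfSpaces u b) F = posHull u (tightAt u b x) := by
  ext w
  constructor
  · intro hw
    exact (mem_posHull_tightAt_iff hb (hF hx)).2 (hw hx).2
  · intro hw y hy
    exact ⟨hF hy, fun z hz => le_dotProduct_of_mem_posHull hz (posHull_mono (h y hy) hw)⟩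

theorem innerNormalFan_halfSpaces (hb : IsCompleteSystem u b) :
    innerNormalFan (halfSpaces u b) = supportCones u b := by
  classical
  ext C
  constructor
  · rintro ⟨F, hF, hne, rfl⟩
    obtain ⟨l, hl⟩ := hF hne
    have hsub : F ⊆ halfSpaces u b := fun y hy => by rw [hl] at hy; exact hy.1
    -- a point of `F` with the fewest tight inequalities lies in the relative interior of `F`
    obtain ⟨T, -, hT⟩ := (Set.toFinite (tightAt u b '' F)).exists_le_minimal
      (hne.image _).some_mem
    obtain ⟨x, hx, rfl⟩ := hT.1
    refine ⟨x, hsub hx, normalCone_eq_posHull hb hsub hx fun y hy => ?_⟩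
    have hmid : ∀ i, u i ⬝ᵥ ((1 / 2 : ℝ) • x + (1 / 2 : ℝ) • y)
        = 1 / 2 * (u i ⬝ᵥ x) + 1 / 2 * (u i ⬝ᵥ y) := fun i => by
      simp [dotProduct_add, dotProduct_smul]
    have hm : (1 / 2 : ℝ) • x + (1 / 2 : ℝ) • y ∈ F := by
      have hx' := hx
      have hy' := hy
      rw [hl] at hx' hy' ⊢
      refine ⟨fun i => ?_, fun z hz => ?_⟩
      · rw [hmid]
        have := hx'.1 i
        have := hy'.1 i
        linarith
      · have := hx'.2 z hz
        have := hy'.2 z hz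
        simp only [map_add, map_smul, smul_eq_mul]
        linarith
    have hle : tightAt u b ((1 / 2 : ℝ) • x + (1 / 2 : ℝ) • y) ⊆ tightAt u b x ∩ tightAt u b y := by
      intro i hi
      have h0 : u i ⬝ᵥ ((1 / 2 : ℝ) • x + (1 / 2 : ℝ) • y) = b i := hi
      rw [hmid] at h0
      have h1 := hsub hx i
      have h2 := hsub hy i
      exact ⟨show u i ⬝ᵥ x = b i by linarith, show u i ⬝ᵥ y = b i by linarith⟩
    intro i hi
    exact (hle (hT.2 ⟨_, hm, rfl⟩ (fun j hj => (hle hj).1) hi)).2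
  · rintro ⟨x, hx, rfl⟩
    let F : Set (V → ℝ) := {y ∈ halfSpaces u b | tightAt u b x ⊆ tightAt u b y}
    have hxF : x ∈ F := ⟨hx, subset_rfl⟩
    refine ⟨F, fun _ => ?_, ⟨x, hxF⟩,
      (normalCone_eq_posHull hb (fun y hy => hy.1) hxF fun y hy => hy.2).symm⟩
    -- the sum of the tight normals exposes the smallest face containing `x`
    let c : ι → ℝ := fun i => if i ∈ tightAt u b x then 1 else 0
    have hc : ∀ i, 0 ≤ c i := fun i => by simp only [c]; split_ifs <;> norm_num
    have hcT : ∀ i, i ∉ tightAt u b x → c i = 0 := fun i hi => by simp [c, hi]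
    let w : V → ℝ := ∑ i, c i • u i
    have hw : w ∈ posHull u (tightAt u b x) := ⟨c, hc, hcT, rfl⟩
    refine ⟨LinearMap.toContinuousLinearMap (-(dotProductBilin ℝ ℝ w)), ?_⟩
    ext y
    simp only [F, Set.mem_ofPred_eq, LinearMap.coe_toContinuousLinearMap', LinearMap.neg_apply,
      dotProductBilin_apply_apply, neg_le_neg_iff]
    refine and_congr_right fun hy => ⟨fun h z hz => ?_, fun h => ?_⟩
    · exact le_dotProduct_of_mem_posHull hz (posHull_mono h hw)
    · intro i hi
      by_contra hiy
      have := eq_zero_of_dotProduct_le hc hcT hy (h x hx) i hiy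
      simp [c, hi] at this

/-! ### The face fan of a polytope with the origin in its interior -/

omit [Fintype V] in
theorem mem_convexHull_range_iff {w : V → ℝ} :
    w ∈ convexHull ℝ (Set.range u) ↔
      ∃ c : ι → ℝ, (∀ i, 0 ≤ c i) ∧ ∑ i, c i = 1 ∧ w = ∑ i, c i • u i := by
  constructor
  · intro hw
    classical
    have := convexHull_min (s := Set.range u)
      (t := (fun c : ι → ℝ => ∑ i, c i • u i) '' stdSimplex ℝ ι) ?_ ?_ hw
    · obtain ⟨c, hc, rfl⟩ := this
      exact ⟨c, hc.1, hc.2, rfl⟩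
    · rintro _ ⟨i, rfl⟩
      refine ⟨Pi.single i 1, single_mem_stdSimplex ℝ i, ?_⟩
      simp [Pi.single_apply, ite_smul]
    · have h : (fun c : ι → ℝ => ∑ i, c i • u i) = Fintype.linearCombination ℝ u := rfl
      rw [h]
      exact (convex_stdSimplex ℝ ι).linear_image _
  · rintro ⟨c, hc, h1, rfl⟩
    exact (convex_convexHull ℝ _).sum_mem (fun i _ => hc i) h1
      fun i _ => subset_convexHull ℝ _ ⟨i, rfl⟩

theorem exists_dotProduct_eq (l : StrongDual ℝ (V → ℝ)) : ∃ f : V → ℝ, ∀ x, l x = x ⬝ᵥ f := by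
  classical
  refine ⟨fun v => l (Pi.single v 1), fun x => ?_⟩
  have h := LinearMap.pi_apply_eq_sum_univ (l : (V → ℝ) →ₗ[ℝ] ℝ) x
  simp only [ContinuousLinearMap.coe_coe, smul_eq_mul] at h
  rw [h]
  simp only [dotProduct]
  refine Finset.sum_congr rfl fun v _ => ?_
  congr 2
  ext j
  simp [Pi.single_apply, eq_comm]

/-- The polar bounds hold on the whole polytope. -/
theorem neg_one_le_of_mem_convexHull {x w : V → ℝ} (hx : x ∈ halfSpaces u fun _ => -1)
    (hw : w ∈ convexHull ℝ (Set.range u)) : -1 ≤ w ⬝ᵥ x := by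
  obtain ⟨c, hc, h1, rfl⟩ := mem_convexHull_range_iff.1 hw
  rw [sum_smul_dotProduct]
  calc (-1 : ℝ) = ∑ i, c i * (-1) := by rw [← Finset.sum_mul, h1, one_mul]
    _ ≤ _ := Finset.sum_le_sum fun i _ => mul_le_mul_of_nonneg_left (hx i) (hc i)

/-- The cone over the face on which `x` attains the polar bound is spanned by the vectors of the
configuration in this face. -/
theorem coneOver_face {x : V → ℝ} (hx : x ∈ halfSpaces u fun _ => -1) :
    coneOver {w | w ∈ convexHull ℝ (Set.range u) ∧ w ⬝ᵥ x = -1} =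
      posHull u (tightAt u (fun _ => -1) x) := by
  ext w
  constructor
  · rintro (rfl | ⟨t, ht, y, ⟨hy, hyx⟩, rfl⟩)
    · exact ⟨fun _ => 0, fun _ => le_rfl, fun _ _ => rfl, by simp⟩
    · obtain ⟨c, hc, h1, rfl⟩ := mem_convexHull_range_iff.1 hy
      refine ⟨fun i => t * c i, fun i => mul_nonneg ht (hc i), fun i hi => ?_, ?_⟩
      · rw [sum_smul_dotProduct] at hyx
        have hle : ∀ i ∈ Finset.univ, c i * (-1) ≤ c i * (u i ⬝ᵥ x) :=
          fun i _ => mul_le_mul_of_nonneg_left (hx i) (hc i)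
        have hsum : ∑ i, c i * (-1 : ℝ) = ∑ i, c i * (u i ⬝ᵥ x) := by
          rw [hyx, ← Finset.sum_mul, h1, one_mul]
        have heq := (Finset.sum_eq_sum_iff_of_le hle).1 hsum
        by_contra hci
        exact hi (mul_left_cancel₀ (right_ne_zero_of_mul hci) (heq i (Finset.mem_univ i))).symm
      · simp [Finset.smul_sum, mul_smul]
  · rintro ⟨c, hc, hT, rfl⟩
    rcases (Finset.sum_nonneg fun i (_ : i ∈ Finset.univ) => hc i).eq_or_lt with h0 | hpos
    · left
      have := (Finset.sum_eq_zero_iff_of_nonneg fun i _ => hc i).1 h0.symm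
      exact Finset.sum_eq_zero fun i hi => by rw [this i hi, zero_smul]
    · right
      set t := ∑ i, c i with ht
      have hy : t⁻¹ • ∑ i, c i • u i = ∑ i, (t⁻¹ * c i) • u i := by
        simp [Finset.smul_sum, mul_smul]
      refine ⟨t, hpos.le, t⁻¹ • ∑ i, c i • u i, ⟨?_, ?_⟩, ?_⟩
      · refine mem_convexHull_range_iff.2 ⟨fun i => t⁻¹ * c i, fun i => ?_, ?_, hy⟩
        · exact mul_nonneg (inv_nonneg.2 hpos.le) (hc i)
        · rw [← Finset.mul_sum, ← ht, inv_mul_cancel₀ hpos.ne']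
      · rw [smul_dotProduct, dotProduct_eq_of_mem_posHull (b := fun _ => (-1 : ℝ)) hT,
          ← Finset.sum_mul, ← ht, smul_eq_mul, ← mul_assoc, inv_mul_cancel₀ hpos.ne', one_mul]
      · rw [smul_smul, mul_inv_cancel₀ hpos.ne', one_smul]

/-- A nonzero vector, scaled to the boundary of the polytope, has a supporting hyperplane. -/
theorem isCompleteSystem_of_zero_mem_interior
    (h0 : (0 : V → ℝ) ∈ interior (convexHull ℝ (Set.range u))) :
    IsCompleteSystem u fun _ => -1 := by
  intro w
  set K := convexHull ℝ (Set.range u) with hK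
  have hconv : Convex ℝ K := convex_convexHull ℝ _
  have hcomp : IsCompact K := (Set.finite_range u).isCompact_convexHull ℝ
  have hnhds : K ∈ nhds (0 : V → ℝ) := mem_interior_iff_mem_nhds.1 h0
  by_cases hw : w = 0
  · exact ⟨0, fun i => by simp, fun _ => 0, fun _ => le_rfl, fun _ _ => rfl, by simp [hw]⟩
  have hg : 0 < gauge K w := (gauge_pos (absorbent_nhds_zero hnhds)
    ((NormedSpace.isVonNBounded_iff ℝ (E := V → ℝ)).2 hcomp.isBounded)).2 hw
  set t := gauge K w with ht
  have hg1 : gauge K (t⁻¹ • w) = 1 := by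
    rw [gauge_smul_of_nonneg (inv_nonneg.2 hg.le), ← ht, smul_eq_mul, inv_mul_cancel₀ hg.ne']
  have hmem : t⁻¹ • w ∈ K := by
    have := (gauge_le_one_iff_mem_closure hconv hnhds).1 hg1.le
    rwa [hcomp.isClosed.closure_eq] at this
  have hnot : t⁻¹ • w ∉ interior K := fun h =>
    hg1.not_lt ((gauge_lt_one_iff_mem_interior hconv hnhds).2 h)
  obtain ⟨l, hl⟩ := geometric_hahn_banach_open_point hconv.interior isOpen_interior hnot
  obtain ⟨f, hf⟩ := exists_dotProduct_eq l
  have hm : 0 < l (t⁻¹ • w) := by simpa using hl 0 h0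
  set m := l (t⁻¹ • w) with hmdef
  have hle : ∀ y ∈ K, l y ≤ m := by
    have hsub : closure (interior K) ⊆ {y | l y ≤ m} :=
      closure_minimal (fun y hy => (hl y hy).le) (isClosed_le l.continuous continuous_const)
    rw [hconv.closure_interior_eq_closure_of_nonempty_interior ⟨0, h0⟩] at hsub
    exact fun y hy => hsub (subset_closure hy)
  have hdot : ∀ y, y ⬝ᵥ (-m⁻¹ • f) = -(m⁻¹ * l y) := fun y => by
    rw [dotProduct_smul, hf y, smul_eq_mul, neg_mul]
  have hx : -m⁻¹ • f ∈ halfSpaces u fun _ => (-1 : ℝ) := by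
    intro i
    rw [hdot, neg_le_neg_iff, ← inv_mul_cancel₀ hm.ne']
    exact mul_le_mul_of_nonneg_left (hle _ (subset_convexHull ℝ _ ⟨i, rfl⟩)) (inv_nonneg.2 hm.le)
  refine ⟨_, hx, ?_⟩
  rw [← coneOver_face hx]
  refine Or.inr ⟨t, hg.le, t⁻¹ • w, ⟨hmem, ?_⟩, ?_⟩
  · rw [hdot, ← hmdef, inv_mul_cancel₀ hm.ne']
  · rw [smul_smul, mul_inv_cancel₀ hg.ne', one_smul]

theorem faceFan_convexHull_range (h0 : (0 : V → ℝ) ∈ interior (convexHull ℝ (Set.range u))) :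
    faceFan (convexHull ℝ (Set.range u)) = supportCones u fun _ => -1 := by
  set K := convexHull ℝ (Set.range u) with hK
  have h0K : (0 : V → ℝ) ∈ K := interior_subset h0
  ext C
  constructor
  · rintro ⟨F, hF, hne, rfl⟩
    by_cases hemp : F.Nonempty
    · obtain ⟨l, hl⟩ := hF hemp
      obtain ⟨x₀, hx₀⟩ := hemp
      have hx₀' := hx₀
      rw [hl] at hx₀'
      set m := l x₀ with hm
      have hm0 : 0 ≤ m := by simpa using hx₀'.2 0 h0K
      have hmpos : 0 < m := by
        refine hm0.lt_of_ne fun hz => hne ?_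
        -- a functional with maximum `0` on a neighbourhood of the origin vanishes
        have hlz : ∀ y, l y = 0 := by
          intro y
          have hlim : Filter.Tendsto (fun t : ℝ => t • y) (nhds 0) (nhds 0) := by
            have : Continuous fun t : ℝ => t • y := by fun_prop
            simpa using this.tendsto 0
          have hev := hlim.eventually (mem_interior_iff_mem_nhds.1 h0)
          obtain ⟨ε, hε, hball⟩ := Metric.eventually_nhds_iff.1 hev
          have hp := hx₀'.2 _ (hball (y := ε / 2)
            (by rw [Real.dist_eq, sub_zero, abs_of_pos (half_pos hε)]; linarith))
          have hn := hx₀'.2 _ (hball (y := -(ε / 2))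
            (by rw [Real.dist_eq, sub_zero, abs_neg, abs_of_pos (half_pos hε)]; linarith))
          rw [map_smul, smul_eq_mul, ← hm, ← hz] at hp hn
          have h1 : l y ≤ 0 := nonpos_of_mul_nonpos_right hp (half_pos hε)
          have h2 : 0 ≤ l y := by nlinarith
          exact le_antisymm h1 h2
        rw [hl]
        exact Set.Subset.antisymm (fun y hy => hy.1) fun y hy => ⟨hy, fun z _ => by simp [hlz]⟩
      obtain ⟨f, hf⟩ := exists_dotProduct_eq l
      have hdot : ∀ y, y ⬝ᵥ (-m⁻¹ • f) = -(m⁻¹ * l y) := fun y => by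
        rw [dotProduct_smul, hf y, smul_eq_mul, neg_mul]
      have hx : -m⁻¹ • f ∈ halfSpaces u fun _ => (-1 : ℝ) := by
        intro i
        rw [hdot, neg_le_neg_iff, ← inv_mul_cancel₀ hmpos.ne']
        exact mul_le_mul_of_nonneg_left (hx₀'.2 _ (subset_convexHull ℝ _ ⟨i, rfl⟩))
          (inv_nonneg.2 hmpos.le)
      refine ⟨_, hx, ?_⟩
      rw [← coneOver_face hx]
      congr 1
      rw [hl]
      ext y
      simp only [Set.mem_ofPred_eq, hdot]
      refine and_congr_right fun hy => ⟨fun h => ?_, fun h z hz => ?_⟩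
      · have : l y = m := le_antisymm (hx₀'.2 y hy) (h x₀ hx₀'.1)
        rw [this, inv_mul_cancel₀ hmpos.ne']
      · have : l y = m := by
          field_simp at h
          linarith
        rw [this]
        exact hx₀'.2 z hz
    · rw [Set.not_nonempty_iff_eq_empty] at hemp
      refine ⟨0, fun i => by simp, ?_⟩
      ext w
      simp only [coneOver, hemp, Set.mem_empty_iff_false, false_and, exists_false, and_false,
        or_false, Set.mem_ofPred_eq]
      constructor
      · rintro rfl
        exact ⟨fun _ => 0, fun _ => le_rfl, fun _ _ => rfl, by simp⟩
      · rintro ⟨c, -, hT, rfl⟩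
        refine Finset.sum_eq_zero fun i _ => ?_
        rw [hT i (by simp [tightAt]), zero_smul]
  · rintro ⟨x, hx, rfl⟩
    refine ⟨{w | w ∈ K ∧ w ⬝ᵥ x = -1}, ?_, ?_, (coneOver_face hx).symm⟩
    · rintro ⟨y₀, hy₀, hy₀x⟩
      refine ⟨LinearMap.toContinuousLinearMap (-(dotProductBilin ℝ ℝ x)), ?_⟩
      ext y
      simp only [Set.mem_ofPred_eq, LinearMap.coe_toContinuousLinearMap', LinearMap.neg_apply,
        dotProductBilin_apply_apply, neg_le_neg_iff, dotProduct_comm x]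
      refine and_congr_right fun hy => ⟨fun h z hz => ?_, fun h => ?_⟩
      · rw [h]; exact neg_one_le_of_mem_convexHull hx hz
      · exact le_antisymm (hy₀x ▸ h y₀ hy₀) (neg_one_le_of_mem_convexHull hx hy)
    · intro h
      have : (0 : V → ℝ) ∈ {w | w ∈ K ∧ w ⬝ᵥ x = -1} := by rw [h]; exact h0K
      simpa using this.2

end Configuration

/-! ### Rank functions from maximal chains -/

section MaximalChains

variable {α : Type*} [PartialOrder α]

theorem isMaxChainBetween_self_iff {a : α} {c : Set α} :
    IsMaxChainBetween a a c ↔ c = {a} := by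
  have ha : ({a} : Set α) ⊆ Set.Icc a a ∧ IsChain (· ≤ ·) ({a} : Set α) := by
    simp [IsChain.singleton]
  constructor
  · intro h
    exact h.eq_of_subset ha (by simpa using h.prop.1)
  · rintro rfl
    exact ⟨ha, fun s hs _ => by simpa using hs.1⟩

theorem IsMaxChainBetween.insert {a b d : α} {c : Set α} (h : IsMaxChainBetween a b c)
    (hab : a ≤ b) (hbd : b ⋖ d) : IsMaxChainBetween a d (insert d c) := by
  have hle : ∀ x ∈ c, x ≤ b := fun x hx => (h.prop.1 hx).2
  have hbc : b ∈ c := by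
    refine h.mem_of_prop_insert ⟨?_, ?_⟩
    · exact Set.insert_subset ⟨hab, le_rfl⟩ h.prop.1
    · exact h.prop.2.insert fun x hx _ => Or.inr (hle x hx)
  refine ⟨⟨?_, ?_⟩, ?_⟩
  · exact Set.insert_subset ⟨hab.trans hbd.le, le_rfl⟩
      (h.prop.1.trans (Set.Icc_subset_Icc_right hbd.le))
  · exact h.prop.2.insert fun x hx _ => Or.inr ((hle x hx).trans hbd.le)
  · intro s hs hcs x hx
    have hcs' : c ⊆ s := (Set.subset_insert d c).trans hcs
    have hlow : s ∩ Set.Iic b ⊆ c := by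
      refine h.2 ⟨fun y hy => ⟨(hs.1 hy.1).1, hy.2⟩, hs.2.mono Set.inter_subset_left⟩ ?_
      exact fun y hy => ⟨hcs' hy, hle y hy⟩
    rcases hs.2.total hx (hcs' hbc) with hxb | hbx
    · exact Or.inr (hlow ⟨hx, hxb⟩)
    · rcases hbd.eq_or_eq hbx (hs.1 hx).2 with rfl | rfl
      · exact Or.inr hbc
      · exact Or.inl rfl

theorem IsMaxChainBetween.ncard_insert [Finite α] {a b d : α} {c : Set α}
    (h : IsMaxChainBetween a b c) (hbd : b ⋖ d) : (Insert.insert d c).ncard = c.ncard + 1 := by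
  refine Set.ncard_insert_of_notMem (fun hd => ?_) c.toFinite
  exact (h.prop.1 hd).2.not_gt hbd.lt

theorem exists_isMaxChainBetween [Finite α] {a b : α} (h : a ≤ b) :
    ∃ c, IsMaxChainBetween a b c := by
  suffices H : a ≤ b ∧ ∃ c, IsMaxChainBetween a b c from H.2
  have := reflTransGen_covBy_of_le h
  clear h
  induction this with
  | refl => exact ⟨le_rfl, {a}, isMaxChainBetween_self_iff.2 rfl⟩
  | tail _ hbd ih =>
    obtain ⟨hab, c, hc⟩ := ih
    exact ⟨hab.trans hbd.le, _, hc.insert hab hbd⟩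

end MaximalChains

section Rank

variable {P : Type*} [PartialOrder P]

/-- A rank function on `P`, normalized so that the adjoined minimum `0̂` would have rank `0`. -/
structure IsRankFunction (r : P → ℕ) : Prop where
  of_isMin : ∀ q, IsMin q → r q = 1
  of_covBy : ∀ p q, p ⋖ q → r q = r p + 1

theorem IsRankedPoset.exists_isRankFunction [Finite P] (hP : IsRankedPoset P) :
    ∃ r : P → ℕ, IsRankFunction r := by
  choose c hc using fun a : WithBot P => exists_isMaxChainBetween (bot_le (a := a))
  have hbot : (c ⊥).ncard = 1 := by
    rw [isMaxChainBetween_self_iff.1 (hc ⊥), Set.ncard_singleton]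
  have hstep : ∀ (a : WithBot P) (q : P), a ⋖ (q : WithBot P) →
      (c q).ncard = (c a).ncard + 1 := fun a q h => by
    rw [hP q _ _ (hc q) ((hc a).insert bot_le h), (hc a).ncard_insert h]
  have hpos : ∀ a, 0 < (c a).ncard := fun a => by
    rcases eq_or_ne (c a).ncard 0 with h | h
    · rw [Set.ncard_eq_zero] at h
      have : (⊥ : WithBot P) ∈ c a := (hc a).mem_of_prop_insert
        ⟨Set.insert_subset ⟨le_rfl, bot_le⟩ (hc a).prop.1,
          (hc a).prop.2.insert fun x _ _ => Or.inl bot_le⟩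
      rw [h] at this
      exact this.elim
    · omega
  refine ⟨fun q => (c q).ncard - 1, fun q hq => ?_, fun p q hpq => ?_⟩
  · have := hstep ⊥ q (WithBot.bot_covBy_coe.2 hq)
    omega
  · have := hstep p q (WithBot.coe_covBy_coe.2 hpq)
    have := hpos p
    omega

theorem bot_covBy_coe_iff {q : P} :
    (⊥ : BoundedExtension P) ⋖ ((q : WithTop P) : BoundedExtension P) ↔ IsMin q := by
  rw [WithBot.bot_covBy_coe]
  constructor
  · intro h p hp
    exact WithTop.coe_le_coe.1 (h (WithTop.coe_le_coe.2 hp))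
  · intro h x hx
    induction x using WithTop.recTopCoe with
    | top => exact absurd hx (by simp)
    | coe p => exact WithTop.coe_le_coe.2 (h (WithTop.coe_le_coe.1 hx))

theorem coe_covBy_coe_iff {p q : P} :
    ((p : WithTop P) : BoundedExtension P) ⋖ ((q : WithTop P) : BoundedExtension P) ↔ p ⋖ q := by
  rw [WithBot.coe_covBy_coe, WithTop.coe_covBy_coe]

theorem coe_covBy_top_iff {p : P} :
    ((p : WithTop P) : BoundedExtension P) ⋖ ⊤ ↔ IsMax p := by
  rw [← WithBot.coe_top, WithBot.coe_covBy_coe, WithTop.coe_covBy_top]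

/-- The maximal chains of the bounded extension through a maximal element `p` of `P` have
`r p + 2` elements. -/
theorem IsGradedPoset.exists_rank_eq [Finite P] (hP : IsGradedPoset P) {r : P → ℕ}
    (hr : IsRankFunction r) : ∃ N : ℕ, ∀ p, IsMax p → r p + 1 = N := by
  have key : ∀ p : P, ∃ c, IsMaxChainBetween (⊥ : BoundedExtension P)
      ((p : WithTop P) : BoundedExtension P) c ∧ c.ncard = r p + 1 := by
    intro p
    induction p using WellFoundedLT.induction with
    | ind p ih =>
      by_cases hp : IsMin p
      · have hcov := bot_covBy_coe_iff.2 hp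
        have h0 := isMaxChainBetween_self_iff.2 (Eq.refl ({⊥} : Set (BoundedExtension P)))
        refine ⟨_, h0.insert le_rfl hcov, ?_⟩
        rw [h0.ncard_insert hcov, hr.of_isMin p hp, Set.ncard_singleton]
      · obtain ⟨q, hq⟩ := not_isMin_iff.1 hp
        rcases (reflTransGen_covBy_of_le hq.le).cases_tail with rfl | ⟨s, -, hs⟩
        · exact absurd hq (lt_irrefl _)
        · obtain ⟨c, hc, hcard⟩ := ih s hs.lt
          have hcov := coe_covBy_coe_iff.2 hs
          exact ⟨_, hc.insert bot_le hcov, by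
            rw [hc.ncard_insert hcov, hcard, hr.of_covBy s p hs]⟩
  have key' : ∀ p : P, IsMax p → ∃ c, IsMaxChainBetween (⊥ : BoundedExtension P) ⊤ c ∧
      c.ncard = r p + 1 + 1 := by
    intro p hp
    obtain ⟨c, hc, hcard⟩ := key p
    have hcov := coe_covBy_top_iff.2 hp
    exact ⟨_, hc.insert bot_le hcov, by rw [hc.ncard_insert hcov, hcard]⟩
  by_cases hne : ∃ p : P, IsMax p
  · obtain ⟨p₀, hp₀⟩ := hne
    refine ⟨r p₀ + 1, fun p hp => ?_⟩
    obtain ⟨c, hc, hcard⟩ := key' p hp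
    obtain ⟨c₀, hc₀, hcard₀⟩ := key' p₀ hp₀
    have := hP c c₀ hc hc₀
    omega
  · exact ⟨0, fun p hp => absurd ⟨p, hp⟩ hne⟩

end Rank

/-! ### The arrows of the quiver of a poset -/

section Arrows

variable {P : Type*} [PartialOrder P] [Fintype P] [Nonempty P]

variable (P) in
/-- The arrows of the quiver of `P`, that is, the covering relations of the bounded extension. -/
abbrev Arrow : Type _ :=
  {e : (P ⊕ Fin 2) × (P ⊕ Fin 2) // (posetQuiver P).Arr e.1 e.2}

noncomputable instance : Fintype (Arrow P) := Fintype.ofFinite _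

/-- The vector attached to an arrow. -/
noncomputable def arrowVec (e : Arrow P) : P → ℝ :=
  StarredQuiver.arrowVector e.1.1 e.1.2

open Classical in
/-- The right-hand sides of the facet inequalities of the order polytope: the arrow `p → 1̂` gives
`-f p ≥ -1`, every other arrow a homogeneous inequality. -/
noncomputable def orderBound (e : Arrow P) : ℝ :=
  if e.1.2 = Sum.inr 1 then -1 else 0

theorem rootPolytope_eq :
    (posetQuiver P).rootPolytope = convexHull ℝ (Set.range (arrowVec (P := P))) := by
  unfold StarredQuiver.rootPolytope
  congr 1
  ext w
  constructor
  · rintro ⟨x, y, h, rfl⟩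
    exact ⟨⟨(x, y), h⟩, rfl⟩
  · rintro ⟨e, rfl⟩
    exact ⟨e.1.1, e.1.2, e.2, rfl⟩

/-- There are three kinds of arrows: between elements of `P`, from `0̂` and to `1̂`. -/
theorem Arrow.cases (e : Arrow P) :
    (∃ p q, e.1 = (Sum.inl p, Sum.inl q) ∧ p ⋖ q) ∨ (∃ q, e.1 = (Sum.inr 0, Sum.inl q) ∧ IsMin q) ∨
      ∃ p, e.1 = (Sum.inl p, Sum.inr 1) ∧ IsMax p := by
  obtain ⟨⟨x, y⟩, h⟩ := e
  have hcov : toBoundedExtension x ⋖ toBoundedExtension y := h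
  rcases x with p | s <;> rcases y with q | t
  · exact Or.inl ⟨p, q, rfl, coe_covBy_coe_iff.1 hcov⟩
  · refine Or.inr (Or.inr ⟨p, ?_⟩)
    fin_cases t
    · exact absurd hcov.lt not_lt_bot
    · exact ⟨rfl, coe_covBy_top_iff.1 hcov⟩
  · refine Or.inr (Or.inl ⟨q, ?_⟩)
    fin_cases s
    · exact ⟨rfl, bot_covBy_coe_iff.1 hcov⟩
    · exact absurd hcov.lt not_top_lt
  · exact absurd h ((posetQuiver P).no_arr_star_star s t)

theorem arrowVec_dotProduct_of_inl_inl {e : Arrow P} {p q : P}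
    (he : e.1 = (Sum.inl p, Sum.inl q)) (f : P → ℝ) : arrowVec e ⬝ᵥ f = f q - f p := by
  classical
  rw [arrowVec, he]
  simp [StarredQuiver.arrowVector, sub_dotProduct]

theorem arrowVec_dotProduct_of_inr_inl {e : Arrow P} {q : P}
    (he : e.1 = (Sum.inr 0, Sum.inl q)) (f : P → ℝ) : arrowVec e ⬝ᵥ f = f q := by
  classical
  rw [arrowVec, he]
  simp [StarredQuiver.arrowVector]

theorem arrowVec_dotProduct_of_inl_inr {e : Arrow P} {p : P}
    (he : e.1 = (Sum.inl p, Sum.inr 1)) (f : P → ℝ) : arrowVec e ⬝ᵥ f = -f p := by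
  classical
  rw [arrowVec, he]
  simp [StarredQuiver.arrowVector]

theorem orderBound_of_inl {e : Arrow P} {x : P ⊕ Fin 2} {q : P} (he : e.1 = (x, Sum.inl q)) :
    orderBound e = 0 := by
  simp [orderBound, he]

theorem orderBound_of_inr {e : Arrow P} {x : P ⊕ Fin 2} (he : e.1 = (x, Sum.inr 1)) :
    orderBound e = -1 := by
  simp [orderBound, he]

/-- For a function `F` on the bounded extension with the boundary values `0` and `1`, the slack of
an arrow is the increase of `F` along it. -/
theorem arrowVec_dotProduct_sub_orderBound (F : BoundedExtension P → ℝ) (h0 : F ⊥ = 0)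
    (h1 : F ⊤ = 1) (e : Arrow P) :
    arrowVec e ⬝ᵥ (fun v => F ((v : WithTop P) : BoundedExtension P)) - orderBound e =
      F (toBoundedExtension e.1.2) - F (toBoundedExtension e.1.1) := by
  rcases e.cases with ⟨p, q, he, -⟩ | ⟨q, he, -⟩ | ⟨p, he, -⟩
  · rw [arrowVec_dotProduct_of_inl_inl he, orderBound_of_inl he, he]
    simp [toBoundedExtension]
  · rw [arrowVec_dotProduct_of_inr_inl he, orderBound_of_inl he, he]
    simp [toBoundedExtension, h0]
  · rw [arrowVec_dotProduct_of_inl_inr he, orderBound_of_inr he, he]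
    simp [toBoundedExtension, h1]
    ring

theorem arrowVec_ne_zero (e : Arrow P) : arrowVec e ≠ 0 := by
  classical
  intro h
  have hdot : ∀ f, arrowVec e ⬝ᵥ f = 0 := fun f => by rw [h, zero_dotProduct]
  rcases e.cases with ⟨p, q, he, hpq⟩ | ⟨q, he, -⟩ | ⟨p, he, -⟩
  · have := hdot (Pi.single q 1)
    rw [arrowVec_dotProduct_of_inl_inl he] at this
    simp [hpq.lt.ne] at this
  · have := hdot (Pi.single q 1)
    rw [arrowVec_dotProduct_of_inr_inl he] at this
    simp at this
  · have := hdot (Pi.single p 1)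
    rw [arrowVec_dotProduct_of_inl_inr he] at this
    simp at this

theorem orderPolytope_eq : orderPolytope P = halfSpaces arrowVec orderBound := by
  ext f
  constructor
  · rintro ⟨h01, hmono⟩ e
    rcases e.cases with ⟨p, q, he, hpq⟩ | ⟨q, he, -⟩ | ⟨p, he, -⟩
    · rw [arrowVec_dotProduct_of_inl_inl he, orderBound_of_inl he]
      exact sub_nonneg.2 (hmono p q hpq.le)
    · rw [arrowVec_dotProduct_of_inr_inl he, orderBound_of_inl he]
      exact (h01 q).1
    · rw [arrowVec_dotProduct_of_inl_inr he, orderBound_of_inr he]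
      exact neg_le_neg (h01 p).2
  · intro hf
    let F : BoundedExtension P → ℝ := WithBot.recBotCoe 0 (WithTop.recTopCoe 1 f)
    have hcov : ∀ a b : BoundedExtension P, a ⋖ b → F a ≤ F b := by
      intro a b hab
      obtain ⟨x, rfl⟩ := toBoundedExtension_surjective a
      obtain ⟨y, rfl⟩ := toBoundedExtension_surjective b
      have h1 := hf ⟨(x, y), hab⟩
      have h2 := arrowVec_dotProduct_sub_orderBound F rfl rfl ⟨(x, y), hab⟩
      have h3 : arrowVec (⟨(x, y), hab⟩ : Arrow P) ⬝ᵥ f - orderBound ⟨(x, y), hab⟩ =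
        F (toBoundedExtension y) - F (toBoundedExtension x) := h2
      linarith
    have hF : Monotone F := by
      intro a b hab
      have := reflTransGen_covBy_of_le hab
      clear hab
      induction this with
      | refl => exact le_rfl
      | tail _ hbc ih => exact ih.trans (hcov _ _ hbc)
    refine ⟨fun v => ⟨hF (bot_le (a := ((v : WithTop P) : BoundedExtension P))),
      hF (le_top (a := ((v : WithTop P) : BoundedExtension P)))⟩, fun v w hvw => ?_⟩
    exact hF (WithBot.coe_le_coe.2 (WithTop.coe_le_coe.2 hvw))

/-! ### The origin is an interior point of the root polytope -/

/-- Along every chain of covering relations of the bounded extension, a positive multiple of the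
sum of the arrow vectors, a telescoping sum, lies in the root polytope. -/
theorem exists_smul_mem_rootPolytope (E : BoundedExtension P → P → ℝ)
    (hE : ∀ e : Arrow P,
      arrowVec e = E (toBoundedExtension e.1.2) - E (toBoundedExtension e.1.1))
    {a b : BoundedExtension P} (hab : a < b) :
    ∃ t : ℝ, 0 < t ∧ t • (E b - E a) ∈ (posetQuiver P).rootPolytope := by
  have hcov : ∀ a b : BoundedExtension P, a ⋖ b →
      E b - E a ∈ (posetQuiver P).rootPolytope := by
    intro a b hab
    obtain ⟨x, rfl⟩ := toBoundedExtension_surjective a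
    obtain ⟨y, rfl⟩ := toBoundedExtension_surjective b
    rw [rootPolytope_eq]
    exact subset_convexHull ℝ _ ⟨⟨(x, y), hab⟩, hE _⟩
  have h := (Relation.reflTransGen_iff_eq_or_transGen.1
    (reflTransGen_covBy_of_le hab.le)).resolve_left hab.ne'
  clear hab
  induction h with
  | single h => exact ⟨1, one_pos, by rw [one_smul]; exact hcov _ _ h⟩
  | @tail b c _ hbc ih =>
    obtain ⟨t, ht, hmem⟩ := ih
    have hconv : Convex ℝ (posetQuiver P).rootPolytope := convex_convexHull ℝ _
    have h1 : (0 : ℝ) < 1 + t := by linarith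
    refine ⟨t / (1 + t), by positivity, ?_⟩
    have := hconv hmem (hcov _ _ hbc) (a := 1 / (1 + t)) (b := t / (1 + t))
      (by positivity) (by positivity) (by field_simp)
    convert this using 1
    rw [smul_smul, ← sub_add_sub_cancel (E c) (E b) (E a), smul_add, add_comm]
    congr 2
    ring

open Classical in
theorem exists_smul_single_mem_rootPolytope (v : P) :
    ∃ ε : ℝ, 0 < ε ∧ ∀ s : ℝ, |s| ≤ ε →
      s • (Pi.single v 1 : P → ℝ) ∈ (posetQuiver P).rootPolytope := by
  let E : BoundedExtension P → P → ℝ :=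
    WithBot.recBotCoe 0 (WithTop.recTopCoe 0 fun v => Pi.single v 1)
  have hE : ∀ e : Arrow P,
      arrowVec e = E (toBoundedExtension e.1.2) - E (toBoundedExtension e.1.1) := by
    intro e
    rcases e.cases with ⟨p, q, he, -⟩ | ⟨q, he, -⟩ | ⟨p, he, -⟩
    · rw [arrowVec, he]
      rfl
    · rw [arrowVec, he]
      exact (sub_zero _).symm
    · rw [arrowVec, he]
      exact (zero_sub _).symm
  obtain ⟨t, ht, hmt⟩ := exists_smul_mem_rootPolytope E hE
    (WithBot.bot_lt_coe ((v : P) : WithTop P))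
  obtain ⟨t', ht', hmt'⟩ := exists_smul_mem_rootPolytope E hE
    (WithBot.coe_lt_coe.2 (WithTop.coe_lt_top v))
  have hmt : t • (Pi.single v 1 - 0 : P → ℝ) ∈ (posetQuiver P).rootPolytope := hmt
  have hmt' : t' • (0 - Pi.single v 1 : P → ℝ) ∈ (posetQuiver P).rootPolytope := hmt'
  have hconv : Convex ℝ (posetQuiver P).rootPolytope := convex_convexHull ℝ _
  refine ⟨min t t', lt_min ht ht', fun s hs => ?_⟩
  have hs1 := (le_abs_self s).trans (hs.trans (min_le_left _ _))
  have hs2 := (neg_abs_le s)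
  have hs3 := hs.trans (min_le_right _ _)
  have hpos : 0 < t + t' := by linarith
  have := hconv hmt hmt' (a := (s + t') / (t + t')) (b := (t - s) / (t + t'))
    (div_nonneg (by linarith) hpos.le) (div_nonneg (by linarith) hpos.le)
    (by field_simp; ring)
  convert this using 1
  rw [sub_zero, zero_sub, smul_neg, smul_neg, smul_smul, smul_smul, ← sub_eq_add_neg, ← sub_smul]
  congr 1
  field_simp
  ring

theorem zero_mem_interior_rootPolytope :
    (0 : P → ℝ) ∈ interior (posetQuiver P).rootPolytope := by
  classical
  choose ε hε hmem using exists_smul_single_mem_rootPolytope (P := P)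
  have hconv : Convex ℝ (posetQuiver P).rootPolytope := convex_convexHull ℝ _
  have hn : (0 : ℝ) < Fintype.card P := by exact_mod_cast Fintype.card_pos
  rw [mem_interior]
  refine ⟨{x | ∀ v, |(Fintype.card P : ℝ) * x v| < ε v}, fun x hx => ?_, ?_, ?_⟩
  · have hsum := hconv.sum_mem (t := Finset.univ) (w := fun _ : P => (Fintype.card P : ℝ)⁻¹)
      (z := fun v => ((Fintype.card P : ℝ) * x v) • (Pi.single v 1 : P → ℝ))
      (fun _ _ => inv_nonneg.2 hn.le) (by simp [hn.ne'])
      (fun v _ => by convert hmem v _ (hx v).le)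
    convert hsum using 1
    ext w
    simp [Finset.sum_apply, Pi.single_apply, hn.ne']
  · rw [Set.ofPred_forall]
    refine isOpen_iInter_of_finite fun v => isOpen_lt ?_ continuous_const
    fun_prop
  · intro v
    simpa using hε v

/-! ### Facets of the two polyhedra -/

/-- Identifying the two ends of a covering relation `a ⋖ b` turns a finite poset into a finite
preorder, `w` being below `v` if `w ≤ v` or if `w ≤ b` and `a ≤ v`.  Counting the elements below
gives a function that is strictly monotone but for the identification. -/
theorem exists_monotone_of_covBy {α : Type*} [PartialOrder α] [Finite α] {a b : α} (hab : a ⋖ b) :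
    ∃ z : α → ℝ, Monotone z ∧ z a = z b ∧ ∀ c d, c < d → z c = z d → c = a ∧ d = b := by
  let S : α → Set α := fun v => {w | w ≤ v ∨ (w ≤ b ∧ a ≤ v)}
  have hS : Monotone S := by
    rintro c d hcd w (hw | ⟨hw, hc⟩)
    · exact Or.inl (hw.trans hcd)
    · exact Or.inr ⟨hw, hc.trans hcd⟩
  refine ⟨fun v => (S v).ncard, fun c d hcd => ?_, ?_, fun c d hcd h => ?_⟩
  · exact Nat.cast_le.2 (Set.ncard_le_ncard (hS hcd) (Set.toFinite _))
  · have : S a = S b := by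
      refine Set.Subset.antisymm (hS hab.le) ?_
      rintro w (hw | ⟨hw, -⟩) <;> exact Or.inr ⟨hw, le_rfl⟩
    simp only [this]
  · have heq : S c = S d := Set.eq_of_subset_of_ncard_le (hS hcd.le)
      (Nat.cast_inj.1 h).ge (Set.toFinite _)
    have hd : d ∈ S c := by rw [heq]; exact Or.inl le_rfl
    rcases hd with hdc | ⟨hdb, hac⟩
    · exact absurd hcd hdc.not_gt
    · rcases hab.eq_or_eq hac (hcd.le.trans hdb) with rfl | rfl
      · exact ⟨rfl, (hab.eq_or_eq hcd.le hdb).resolve_left hcd.ne'⟩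
      · exact absurd hcd hdb.not_gt

/-- Every arrow gives a facet of the order polytope. -/
theorem exists_tightAt_orderBound_eq_singleton (e : Arrow P) :
    ∃ x ∈ halfSpaces arrowVec orderBound, tightAt arrowVec orderBound x = {e} := by
  have hcov : toBoundedExtension e.1.1 ⋖ toBoundedExtension e.1.2 := e.2
  obtain ⟨z, hmono, hz, hinj⟩ := exists_monotone_of_covBy hcov
  obtain ⟨v⟩ := ‹Nonempty P›
  have hpos : 0 < z ⊤ - z ⊥ := by
    refine sub_pos.2 ((hmono bot_le).lt_of_ne fun h => ?_)
    have hbot : (⊥ : BoundedExtension P) < ((v : WithTop P) : BoundedExtension P) :=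
      WithBot.bot_lt_coe _
    have htop : ((v : WithTop P) : BoundedExtension P) < ⊤ :=
      WithBot.coe_lt_coe.2 (WithTop.coe_lt_top v)
    obtain ⟨h1, h2⟩ := hinj _ _ (hbot.trans htop) h
    rw [← h1, ← h2] at hcov
    exact hcov.2 hbot htop
  let F : BoundedExtension P → ℝ := fun a => (z a - z ⊥) / (z ⊤ - z ⊥)
  have hslack : ∀ e' : Arrow P,
      arrowVec e' ⬝ᵥ (fun v => F ((v : WithTop P) : BoundedExtension P)) - orderBound e' =
        (z (toBoundedExtension e'.1.2) - z (toBoundedExtension e'.1.1)) / (z ⊤ - z ⊥) := by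
    intro e'
    rw [arrowVec_dotProduct_sub_orderBound F (by simp [F]) (div_self hpos.ne') e',
      ← sub_div, sub_sub_sub_cancel_right]
  have hcov' : ∀ e' : Arrow P, toBoundedExtension e'.1.1 ⋖ toBoundedExtension e'.1.2 :=
    fun e' => e'.2
  refine ⟨fun v => F ((v : WithTop P) : BoundedExtension P), fun e' => sub_nonneg.1 ?_, ?_⟩
  · rw [hslack]
    exact div_nonneg (sub_nonneg.2 (hmono (hcov' e').le)) hpos.le
  · ext e'
    rw [Set.mem_singleton_iff, tightAt, Set.mem_ofPred_eq, ← sub_eq_zero, hslack,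
      div_eq_zero_iff, or_iff_left hpos.ne', sub_eq_zero]
    constructor
    · intro h
      obtain ⟨h1, h2⟩ := hinj _ _ (hcov' e').lt h.symm
      exact Subtype.ext (Prod.ext (toBoundedExtension_injective h1)
        (toBoundedExtension_injective h2))
    · rintro rfl
      exact hz.symm

/-- Every arrow gives a facet of the polar of the root polytope.  If the arrow does not end in `1̂`,
take half a relative interior point of the corresponding facet of the order polytope, translated
by minus the rank function; for an arrow `p → 1̂` take the unit vector at `p`. -/
theorem exists_tightAt_neg_one_eq_singleton {r : P → ℕ} (hr : IsRankFunction r) (e : Arrow P) :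
    ∃ x ∈ halfSpaces arrowVec (fun _ : Arrow P => (-1 : ℝ)),
      tightAt arrowVec (fun _ => (-1 : ℝ)) x = {e} := by
  classical
  by_cases he : e.1.2 = Sum.inr 1
  · obtain ⟨p, hep, hp⟩ : ∃ p, e.1 = (Sum.inl p, Sum.inr 1) ∧ IsMax p := by
      rcases e.cases with ⟨p, q, h, -⟩ | ⟨q, h, -⟩ | h
      · simp [h] at he
      · simp [h] at he
      · exact h
    have key : ∀ e' : Arrow P, -1 ≤ arrowVec e' ⬝ᵥ (Pi.single p 1 : P → ℝ) ∧
        (arrowVec e' ⬝ᵥ (Pi.single p 1 : P → ℝ) = -1 ↔ e' = e) := by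
      intro e'
      rw [Subtype.ext_iff, hep]
      rcases e'.cases with ⟨p', q', h, hpq⟩ | ⟨q', h, -⟩ | ⟨p', h, -⟩
      · have : p' ≠ p := fun hpp => hp.not_lt (hpp ▸ hpq.lt)
        rw [arrowVec_dotProduct_of_inl_inl h, h]
        by_cases hq : q' = p
        · subst hq; simp [this]; norm_num
        · simp [this, hq]
      · rw [arrowVec_dotProduct_of_inr_inl h, h]
        by_cases hq : q' = p
        · subst hq; simp; norm_num
        · simp [hq]
      · rw [arrowVec_dotProduct_of_inl_inr h, h]
        by_cases hq : p' = p
        · subst hq; simp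
        · simp [hq]
    exact ⟨_, fun e' => (key e').1, Set.ext fun e' => (key e').2⟩
  · obtain ⟨y, hy, hye⟩ := exists_tightAt_orderBound_eq_singleton e
    have hy1 : ∀ v, y v ≤ 1 := by
      rw [← orderPolytope_eq] at hy
      exact fun v => (hy.1 v).2
    let x : P → ℝ := fun v => y v / 2 - r v
    have key : ∀ e' : Arrow P, -1 ≤ arrowVec e' ⬝ᵥ x ∧
        (arrowVec e' ⬝ᵥ x = -1 ↔ e' ∈ tightAt arrowVec orderBound y) := by
      intro e'
      have hye' := hy e'
      simp only [tightAt, Set.mem_ofPred_eq]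
      rcases e'.cases with ⟨p', q', h, hpq⟩ | ⟨q', h, hq⟩ | ⟨p', h, -⟩
      · rw [arrowVec_dotProduct_of_inl_inl h, orderBound_of_inl h] at hye'
        rw [arrowVec_dotProduct_of_inl_inl h, arrowVec_dotProduct_of_inl_inl h,
          orderBound_of_inl h]
        simp only [x, hr.of_covBy _ _ hpq, Nat.cast_add, Nat.cast_one]
        exact ⟨by linarith, fun h => by linarith, fun h => by linarith⟩
      · rw [arrowVec_dotProduct_of_inr_inl h, orderBound_of_inl h] at hye'
        rw [arrowVec_dotProduct_of_inr_inl h, arrowVec_dotProduct_of_inr_inl h,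
          orderBound_of_inl h]
        simp only [x, hr.of_isMin _ hq, Nat.cast_one]
        exact ⟨by linarith, fun h => by linarith, fun h => by linarith⟩
      · have hne : e' ∉ tightAt arrowVec orderBound y := by
          rw [hye, Set.mem_singleton_iff]
          rintro rfl
          exact he (by rw [h])
        simp only [tightAt, Set.mem_ofPred_eq] at hne
        rw [iff_false_intro hne, iff_false, arrowVec_dotProduct_of_inl_inr h]
        simp only [x]
        have h1 := hy1 p'
        have h2 : (0 : ℝ) ≤ r p' := Nat.cast_nonneg _
        exact ⟨by linarith, by intro h; linarith⟩
    refine ⟨x, fun e' => (key e').1, ?_⟩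
    rw [← hye]
    exact Set.ext fun e' => (key e').2

/-! ### Comparison through the rank function -/

/-- If `x` satisfies the polar inequalities, `x + r` is monotone, and the filter where it is
positive is a vertex of the order polytope at which all inequalities tight at `x` are tight. -/
theorem exists_tightAt_subset {r : P → ℕ} (hr : IsRankFunction r) {x : P → ℝ}
    (hx : x ∈ halfSpaces arrowVec (fun _ : Arrow P => (-1 : ℝ))) :
    ∃ y ∈ halfSpaces (arrowVec (P := P)) orderBound,
      tightAt arrowVec (fun _ => (-1 : ℝ)) x ⊆ tightAt arrowVec orderBound y := by
  classical
  let y : P → ℝ := fun v => if 0 < x v + r v then 1 else 0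
  have hy0 : ∀ v, 0 ≤ y v := fun v => by simp only [y]; split_ifs <;> norm_num
  have hy1 : ∀ v, y v ≤ 1 := fun v => by simp only [y]; split_ifs <;> norm_num
  have key : ∀ e : Arrow P, orderBound e ≤ arrowVec e ⬝ᵥ y ∧
      (arrowVec e ⬝ᵥ x = -1 → arrowVec e ⬝ᵥ y = orderBound e) := by
    intro e
    have hxe := hx e
    rcases e.cases with ⟨p, q, h, hpq⟩ | ⟨q, h, hq⟩ | ⟨p, h, -⟩
    · rw [arrowVec_dotProduct_of_inl_inl h] at hxe
      rw [arrowVec_dotProduct_of_inl_inl h, arrowVec_dotProduct_of_inl_inl h, orderBound_of_inl h]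
      simp only [y, hr.of_covBy _ _ hpq, Nat.cast_add, Nat.cast_one]
      constructor
      · split_ifs <;> linarith
      · intro heq
        have : x q + (r p + 1) = x p + r p := by linarith
        rw [this, sub_self]
    · rw [arrowVec_dotProduct_of_inr_inl h, arrowVec_dotProduct_of_inr_inl h, orderBound_of_inl h]
      refine ⟨hy0 q, fun heq => ?_⟩
      simp [y, heq, hr.of_isMin _ hq]
    · rw [arrowVec_dotProduct_of_inl_inr h, arrowVec_dotProduct_of_inl_inr h, orderBound_of_inr h]
      refine ⟨neg_le_neg (hy1 p), fun heq => ?_⟩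
      have h2 : (0 : ℝ) ≤ r p := Nat.cast_nonneg _
      simp only [y]
      rw [if_pos (by linarith)]
  exact ⟨y, fun e => (key e).1, fun e => (key e).2⟩

/-- For a graded poset of total rank `N`, the two polyhedra differ by the translation by the rank
function and the dilation by `N`. -/
theorem supportCones_eq_of_forall_isMax {r : P → ℕ} (hr : IsRankFunction r) {N : ℕ}
    (hN : ∀ p, IsMax p → r p + 1 = N) :
    supportCones arrowVec (fun _ : Arrow P => (-1 : ℝ)) =
      supportCones (arrowVec (P := P)) orderBound := by
  have hpos : (0 : ℝ) < N := by
    obtain ⟨v⟩ := ‹Nonempty P›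
    obtain ⟨p, -, hp⟩ := (Set.finite_univ (α := P)).exists_le_maximal (Set.mem_univ v)
    have := hN p (fun q hq => hp.2 (Set.mem_univ q) hq)
    exact_mod_cast (by omega : 0 < N)
  have hslack : ∀ (x y : P → ℝ), (∀ v, N * y v = x v + r v) → ∀ e : Arrow P,
      N * (arrowVec e ⬝ᵥ y - orderBound e) = arrowVec e ⬝ᵥ x + 1 := by
    intro x y hxy e
    rcases e.cases with ⟨p, q, h, hpq⟩ | ⟨q, h, hq⟩ | ⟨p, h, hp⟩
    · rw [arrowVec_dotProduct_of_inl_inl h, arrowVec_dotProduct_of_inl_inl h, orderBound_of_inl h,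
        sub_zero, mul_sub, hxy, hxy, hr.of_covBy _ _ hpq]
      push_cast
      ring
    · rw [arrowVec_dotProduct_of_inr_inl h, arrowVec_dotProduct_of_inr_inl h, orderBound_of_inl h,
        sub_zero, hxy, hr.of_isMin _ hq, Nat.cast_one]
    · rw [arrowVec_dotProduct_of_inl_inr h, arrowVec_dotProduct_of_inl_inr h, orderBound_of_inr h,
        mul_sub, mul_neg, hxy, ← hN p hp]
      push_cast
      ring
  have htight : ∀ (x y : P → ℝ), (∀ v, N * y v = x v + r v) →
      tightAt arrowVec (fun _ : Arrow P => (-1 : ℝ)) x = tightAt arrowVec orderBound y := by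
    intro x y hxy
    ext e
    have := hslack x y hxy e
    simp only [tightAt, Set.mem_ofPred_eq]
    rw [← sub_eq_zero (b := orderBound e), ← mul_eq_zero_iff_left hpos.ne', this,
      eq_neg_iff_add_eq_zero]
  have hmem : ∀ (x y : P → ℝ), (∀ v, N * y v = x v + r v) →
      (x ∈ halfSpaces arrowVec (fun _ : Arrow P => (-1 : ℝ)) ↔
        y ∈ halfSpaces (arrowVec (P := P)) orderBound) := by
    intro x y hxy
    refine forall_congr' fun e => ?_
    rw [← sub_nonneg (b := orderBound e), ← mul_nonneg_iff_of_pos_left hpos, hslack x y hxy e,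
      neg_le_iff_add_nonneg]
  ext C
  constructor
  · rintro ⟨x, hx, rfl⟩
    have hxy : ∀ v, N * ((x v + r v) / N) = x v + r v := fun v => by field_simp
    exact ⟨fun v => (x v + r v) / N, (hmem _ _ hxy).1 hx, by rw [htight _ _ hxy]⟩
  · rintro ⟨y, hy, rfl⟩
    have hxy : ∀ v, N * y v = (N * y v - r v) + r v := fun v => by ring
    exact ⟨fun v => N * y v - r v, (hmem _ _ hxy).2 hy, by rw [htight _ _ hxy]⟩

end Arrows

theorem theoremD (P : Type*) [PartialOrder P] [Fintype P] [Nonempty P] (hP : IsRankedPoset P) :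
    -- the origin is an interior point of the root polytope, so that its face fan is defined
    (0 : P → ℝ) ∈ interior (posetQuiver P).rootPolytope ∧
    -- the two fans have the same rays
    fanRays (faceFan (posetQuiver P).rootPolytope) =
      fanRays (innerNormalFan (orderPolytope P)) ∧
    -- each maximal cone of the face fan is contained in a maximal cone of the normal fan
    (∀ C ∈ maximalCones (faceFan (posetQuiver P).rootPolytope),
      ∃ D ∈ maximalCones (innerNormalFan (orderPolytope P)), C ⊆ D) ∧
    -- each maximal cone of the normal fan is a union of maximal cones of the face fan
    (∀ D ∈ maximalCones (innerNormalFan (orderPolytope P)),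
      ∃ S ⊆ maximalCones (faceFan (posetQuiver P).rootPolytope), D = ⋃₀ S) ∧
    -- if the poset is graded, then the two fans coincide
    (IsGradedPoset P →
      faceFan (posetQuiver P).rootPolytope = innerNormalFan (orderPolytope P)) := by 
  obtain ⟨r, hr⟩ := hP.exists_isRankFunction
  have h0 : (0 : P → ℝ) ∈ interior (posetQuiver P).rootPolytope := zero_mem_interior_rootPolytope
  have h0' := h0
  rw [rootPolytope_eq] at h0'
  have hcomplete := isCompleteSystem_of_zero_mem_interior h0'
  have H : ∀ x ∈ halfSpaces arrowVec (fun _ : Arrow P => (-1 : ℝ)),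
      ∃ y ∈ halfSpaces (arrowVec (P := P)) orderBound,
        tightAt arrowVec (fun _ => (-1 : ℝ)) x ⊆ tightAt arrowVec orderBound y :=
    fun x hx => exists_tightAt_subset hr hx
  have hface : faceFan (posetQuiver P).rootPolytope =
      supportCones arrowVec (fun _ : Arrow P => (-1 : ℝ)) := by
    rw [rootPolytope_eq, faceFan_convexHull_range h0']
  have hnormal : innerNormalFan (orderPolytope P) =
      supportCones (arrowVec (P := P)) orderBound := by
    rw [orderPolytope_eq, innerNormalFan_halfSpaces (hcomplete.of_refines H)]
  rw [hface, hnormal]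
  refine ⟨h0, ?_, fun C hC => exists_maximal_superset H hC.1,
    fun D hD => eq_sUnion_maximalCones hcomplete H hD, fun hgraded => ?_⟩
  · rw [fanRays_supportCones arrowVec_ne_zero (exists_tightAt_neg_one_eq_singleton hr),
      fanRays_supportCones arrowVec_ne_zero exists_tightAt_orderBound_eq_singleton]
  · obtain ⟨N, hN⟩ := hgraded.exists_rank_eq hr
    exact supportCones_eq_of_forall_isMax hr hN
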